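/- Let $\mathbb{M}^{10,1}=\mathbb{E}^{10}\oplus\mathbb{R}e_0$ be eleven-dimensional Minkowski space with the quadratic form $Q(x+te_0)=\|x\|^2-t^2$, let $\mathrm{C}\ell(10,1)$ be its real Clifford algebra (with $v\cdot v=Q(v)$), identified as a vector space with the exterior algebra $\bigwedge\mathbb{M}^{10,1}$ in the canonical way, and let $S$ be a space of Majorana spinors, that is, a real $\mathrm{C}\ell(10,1)$-module with $\dim_{\mathbb{R}}S=32$. Let $e_1,\dots,e_{10}$ be an orthonormal frame of $\mathbb{E}^{10}$ and let $\xi=e_1\wedge e_3\wedge e_5\wedge e_7\wedge e_9$. For $\theta=(\theta_1,\dots,\theta_5)\in(\mathbb{R}/2\pi\mathbb{Z})^5$ let $R(\theta)\in\mathrm{SO}(10)$ be the rotation by the angle $\theta_k$ in each oriented plane $(e_{2k-1},e_{2k})$, $k=1,\dots,5$, so that $$R(\theta)\xi=(\cos\theta_1e_1+\sin\theta_1e_2)\wedge\cdots\wedge(\cos\theta_5e_9+\sin\theta_5e_{10}).$$ Let $\mathcal{M}$ be the quotient of the maximal torus $(\mathbb{R}/2\pi\mathbb{Z})^5$ by the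 Weyl group of $\mathrm{SO}(10)$, which acts by permutations of the five angles and by changes of an even number of signs; write $[\theta]$ for the class of $\theta$. Let $\mathcal{M}_{\mathrm{susy}}\subset\mathcal{M}$ be the set of classes $[\theta]$ of those $\theta$ for which the equations $$(e_0\wedge\xi)\cdot\varepsilon=\varepsilon\qquad\text{and}\qquad(e_0\wedge R(\theta)\xi)\cdot\varepsilon=\varepsilon\tag{$*$}$$ have a common nonzero solution $\varepsilon\in S$. Then $$\mathcal{M}_{\mathrm{susy}}=\{[\theta]\in\mathcal{M}\mid\theta_1+\theta_2+\theta_3+\theta_4\equiv\theta_5\ \mathrm{mod}\ 2\pi\},$$ where the condition on the right means that some representative of the class satisfies the congruence. Moreover, for every $\theta$, the equations $(*)$ have a nonzero solution if and only if $[\theta]$ belongs to this set. For every $\theta$, the dimension $32\,\nu([\theta])$ of the real vector space of solutions $\varepsilon\in S$ of $(*)$ depends only on $[\theta]$, and it is equal to the number of sign vectors $\sigma\in\{\pm1\}^5$ with $\sigma_1\sigma_2\sigma_3\sigma_4\sigma_5=-1$ and $\sum_{i=1}^5\sigma_i\theta_i\equiv0\ \mathrm{mod}\ 2\pi$. -/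

import Mathlib

open scoped BigOperators

noncomputable section

namespace M5Brane

/-- Euclidean space of dimension ten. -/
abbrev E10 : Type := EuclideanSpace ℝ (Fin 10)

/-- Minkowski space `𝔼¹⁰ ⊕ ℝ e₀`. -/
abbrev Minkowski : Type := E10 × ℝ

/-- The Minkowski quadratic form `(x, t) ↦ ‖x‖² - t²`, of signature (ten plus, one minus). -/
def minkowskiForm : QuadraticForm ℝ Minkowski :=
  QuadraticMap.prod (LinearMap.BilinMap.toQuadraticMap (innerₗ E10)) (-QuadraticMap.sq)

theorem minkowskiForm_apply (x : E10) (t : ℝ) : minkowskiForm (x, t) = ‖x‖ ^ 2 - t * t := by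
  simp [minkowskiForm, sub_eq_add_neg]

/-- The real Clifford algebra `Cℓ(10,1)`, with the convention `v * v = minkowskiForm v`. -/
abbrev Cl : Type := CliffordAlgebra minkowskiForm

/-- The unit time-like vector `e₀`. -/
def e0 : Minkowski := (0, 1)

/-- The element of the Clifford algebra that corresponds to `e₀ ∧ ξ`, for a multivector `ξ` of
`𝔼¹⁰`, under the canonical linear isomorphism of the Clifford and the exterior algebra. -/
def e0WedgeCl (ξ : ExteriorAlgebra ℝ E10) : Cl :=
  letI : Invertible (2 : ℝ) := invertibleOfNonzero two_ne_zero
  (CliffordAlgebra.equivExterior minkowskiForm).symm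
    (ExteriorAlgebra.ι ℝ e0 * ExteriorAlgebra.map (LinearMap.inl ℝ E10 ℝ) ξ)

/-- An orthonormal frame of `𝔼¹⁰`, grouped into five pairs: the `k`-th pair is
`e (0, k), e (1, k)`. -/
abbrev Frame : Type := OrthonormalBasis (Fin 2 × Fin 5) ℝ E10

/-- Five angles modulo `2π`: the standard maximal torus of `SO(10)`. -/
abbrev Torus : Type := Fin 5 → Real.Angle

/-- The block-diagonal matrix whose `k`-th block is the rotation by the angle `θ k`. -/
def rotationMatrix (θ : Torus) : Matrix (Fin 2 × Fin 5) (Fin 2 × Fin 5) ℝ :=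
  Matrix.blockDiagonal fun k =>
    !![(θ k).cos, -(θ k).sin; (θ k).sin, (θ k).cos]

theorem rotationMatrix_mem (θ : Torus) :
    rotationMatrix θ ∈ Matrix.specialOrthogonalGroup (Fin 2 × Fin 5) ℝ := by
  rw [Matrix.mem_specialOrthogonalGroup_iff, Matrix.mem_orthogonalGroup_iff]
  have h : ∀ k, (θ k).cos ^ 2 + (θ k).sin ^ 2 = 1 := fun k => (θ k).cos_sq_add_sin_sq
  constructor
  · rw [rotationMatrix, Matrix.blockDiagonal_transpose, ← Matrix.blockDiagonal_mul,
      ← Matrix.blockDiagonal_one]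
    congr 1
    funext k
    ext i j
    fin_cases i <;> fin_cases j <;> simp [Matrix.mul_apply, Fin.sum_univ_two] <;>
      linarith [h k]
  · rw [rotationMatrix, Matrix.det_blockDiagonal]
    refine Finset.prod_eq_one fun k _ => ?_
    rw [Matrix.det_fin_two_of]
    linarith [h k]

/-- The rotation `R(θ)` of `𝔼¹⁰` with block-diagonal matrix `rotationMatrix θ` in the frame `e`. -/
def rotation (e : Frame) (θ : Torus) : E10 →ₗ[ℝ] E10 :=
  Matrix.toLin e.toBasis e.toBasis (rotationMatrix θ)

theorem rotation_apply_zero (e : Frame) (θ : Torus) (k : Fin 5) :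
    rotation e θ (e (0, k)) = (θ k).cos • e (0, k) + (θ k).sin • e (1, k) := by
  have h := Matrix.toLin_self e.toBasis e.toBasis (rotationMatrix θ) (0, k)
  simp only [OrthonormalBasis.coe_toBasis] at h
  rw [rotation, h, Fintype.sum_prod_type]
  simp [rotationMatrix, Matrix.blockDiagonal_apply, Fin.sum_univ_two]

theorem rotation_apply_one (e : Frame) (θ : Torus) (k : Fin 5) :
    rotation e θ (e (1, k)) = -(θ k).sin • e (0, k) + (θ k).cos • e (1, k) := by
  have h := Matrix.toLin_self e.toBasis e.toBasis (rotationMatrix θ) (1, k)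
  simp only [OrthonormalBasis.coe_toBasis] at h
  rw [rotation, h, Fintype.sum_prod_type]
  simp [rotationMatrix, Matrix.blockDiagonal_apply, Fin.sum_univ_two]

/-- The unit simple 5-vector `ξ`, the wedge product of the first vectors of the five pairs. -/
def plane (e : Frame) : ExteriorAlgebra ℝ E10 :=
  ExteriorAlgebra.ιMulti ℝ 5 fun k => e (0, k)

/-- The 5-vector `R(θ) ξ`. -/
def rotatedPlane (e : Frame) (θ : Torus) : ExteriorAlgebra ℝ E10 :=
  ExteriorAlgebra.map (rotation e θ) (plane e)

theorem rotatedPlane_eq (e : Frame) (θ : Torus) :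
    rotatedPlane e θ =
      ExteriorAlgebra.ιMulti ℝ 5 fun k => (θ k).cos • e (0, k) + (θ k).sin • e (1, k) := by
  rw [rotatedPlane, plane, ExteriorAlgebra.map_apply_ιMulti]
  congr 1
  funext k
  exact rotation_apply_zero e θ k

/-- Two elements of the torus are related by the Weyl group of `SO(10)`: a permutation of the
five angles together with an even number of sign changes. -/
def weylRel (θ θ' : Torus) : Prop :=
  ∃ (p : Equiv.Perm (Fin 5)) (s : Fin 5 → ℤˣ), ∏ i, s i = 1 ∧
    ∀ i, θ' i = ((s i : ℤˣ) : ℤ) • θ (p i)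

theorem weylRel_equivalence : Equivalence weylRel where
  refl θ := ⟨1, fun _ => 1, by simp, by simp⟩
  symm := by
    rintro θ θ' ⟨p, s, hs, h⟩
    refine ⟨p⁻¹, fun i => s (p⁻¹ i), ?_, fun i => ?_⟩
    · rw [← hs]; exact Equiv.prod_comp p⁻¹ s
    · rw [h, smul_smul, ← Units.val_mul, ← sq, Int.units_sq]
      simp
  trans := by
    rintro θ θ' θ'' ⟨p, s, hs, h⟩ ⟨q, t, ht, h'⟩
    refine ⟨p * q, fun i => t i * s (q i), ?_, fun i => ?_⟩
    · rw [Finset.prod_mul_distrib, ht, Equiv.prod_comp q s, hs, one_mul]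
    · rw [h', h, smul_smul, ← Units.val_mul]
      simp

/-- The orbit equivalence relation of the Weyl group of `SO(10)` on the maximal torus. -/
def weylSetoid : Setoid Torus := ⟨weylRel, weylRel_equivalence⟩

/-- The space of possible angles: the quotient of the maximal torus by the Weyl group. -/
abbrev AngleSpace : Type := Quotient weylSetoid

/-- The class of five angles in the space of possible angles. -/
def angleClass (θ : Torus) : AngleSpace := Quotient.mk weylSetoid θ

section Spinors

variable {S : Type*} [AddCommGroup S] [Module ℝ S]

/-- The space of solutions `ε` of `(e₀ ∧ ξ) · ε = ε` and `(e₀ ∧ R(θ) ξ) · ε = ε`, where the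
Clifford algebra acts on the spinors through `ρ`. -/
def solutionSpace (ρ : Cl →ₐ[ℝ] Module.End ℝ S) (e : Frame) (θ : Torus) : Submodule ℝ S :=
  LinearMap.eqLocus (ρ (e0WedgeCl (plane e))) LinearMap.id ⊓
    LinearMap.eqLocus (ρ (e0WedgeCl (rotatedPlane e θ))) LinearMap.id

theorem mem_solutionSpace (ρ : Cl →ₐ[ℝ] Module.End ℝ S) (e : Frame) (θ : Torus) (ε : S) :
    ε ∈ solutionSpace ρ e θ ↔
      ρ (e0WedgeCl (plane e)) ε = ε ∧ ρ (e0WedgeCl (rotatedPlane e θ)) ε = ε :=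
  Iff.rfl

/-- The set of classes of angles for which the configuration of the two planes `ξ` and `R(θ) ξ`
preserves some supersymmetry. -/
def susyAngles (ρ : Cl →ₐ[ℝ] Module.End ℝ S) (e : Frame) : Set AngleSpace :=
  {m | ∃ θ : Torus, angleClass θ = m ∧ ∃ ε : S, ε ≠ 0 ∧
    ρ (e0WedgeCl (plane e)) ε = ε ∧ ρ (e0WedgeCl (rotatedPlane e θ)) ε = ε}

end Spinors

/-- A sum of signed angles, `σ₁ θ₁ + ⋯ + σ₅ θ₅`, as an angle modulo `2π`. -/
def signedSum (σ : Fin 5 → ℤˣ) (θ : Torus) : Real.Angle := ∑ i, ((σ i : ℤˣ) : ℤ) • θ i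

/-! Real 32-component spinor modules of `Cℓ(10,1)` exist: eleven explicit gamma matrices, each
of them a signed permutation matrix given by two bit masks. -/

/-- The masks of the permutations `v ↦ v xor (flipMask i)`. -/
def flipMask : Fin 11 → ℕ := ![0, 1, 3, 7, 11, 15, 19, 23, 27, 31, 1]

/-- The masks of the signs. -/
def signMask : Fin 11 → ℕ := ![1, 2, 0, 6, 14, 26, 30, 18, 22, 10, 1]

/-- The permutation of the 32 indices that belongs to the `i`-th gamma matrix. -/
def gammaFlip (i : Fin 11) (v : Fin 32) : Fin 32 :=
  ⟨(v.1 ^^^ flipMask i) % 32, Nat.mod_lt _ (by norm_num)⟩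

/-- The signs that belong to the `i`-th gamma matrix. -/
def gammaSign (i : Fin 11) (v : Fin 32) : ℤ :=
  if ((List.range 5).countP fun n => v.1.testBit n && (signMask i).testBit n) % 2 = 0
  then 1 else -1

/-- The `i`-th gamma matrix as an operator; the first ten have square one, the last minus one. -/
def gamma (i : Fin 11) : Module.End ℝ (Fin 32 → ℝ) where
  toFun f v := (gammaSign i v : ℝ) * f (gammaFlip i v)
  map_add' f g := by funext v; simp [mul_add]
  map_smul' c f := by funext v; simp [mul_left_comm]

/-- The signature of the eleven gamma matrices. -/
def gammaEta (i : Fin 11) : ℤ := if i = 10 then -1 else 1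

theorem gammaFlip_comm : ∀ (i j : Fin 11) (v : Fin 32),
    gammaFlip j (gammaFlip i v) = gammaFlip i (gammaFlip j v) := by decide +kernel

theorem gammaFlip_self : ∀ (i : Fin 11) (v : Fin 32),
    gammaFlip i (gammaFlip i v) = v := by decide +kernel

theorem gammaSign_anti : ∀ (i j : Fin 11) (v : Fin 32),
    gammaSign i v * gammaSign j (gammaFlip i v) + gammaSign j v * gammaSign i (gammaFlip j v) =
      if i = j then 2 * gammaEta i else 0 := by decide +kernel

theorem gamma_anti (i j : Fin 11) :
    gamma i * gamma j + gamma j * gamma i =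
      (if i = j then 2 * (gammaEta i : ℝ) else 0) • (1 : Module.End ℝ (Fin 32 → ℝ)) := by
  refine LinearMap.ext fun f => funext fun v => ?_
  have h : ((gammaSign i v * gammaSign j (gammaFlip i v) +
      gammaSign j v * gammaSign i (gammaFlip j v) : ℤ) : ℝ) =
      ((if i = j then 2 * gammaEta i else 0 : ℤ) : ℝ) := by
    rw [gammaSign_anti]
  push_cast at h
  have h1 : (gamma i * gamma j + gamma j * gamma i) f v =
      ((gammaSign i v : ℝ) * gammaSign j (gammaFlip i v) +
        gammaSign j v * gammaSign i (gammaFlip j v)) * f (gammaFlip j (gammaFlip i v)) := by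
    simp only [gamma, LinearMap.add_apply, Module.End.mul_apply, LinearMap.coe_mk,
      AddHom.coe_mk, Pi.add_apply, gammaFlip_comm j i v]
    ring
  rw [h1, h]
  by_cases hij : i = j
  · subst hij
    simp [gammaFlip_self]
  · simp [hij]

/-- Clifford multiplication by a vector, in terms of the gamma matrices. -/
def gammaVec : Minkowski →ₗ[ℝ] Module.End ℝ (Fin 32 → ℝ) :=
  ∑ i : Fin 11, LinearMap.smulRight
    (Fin.lastCases (motive := fun _ => Minkowski →ₗ[ℝ] ℝ) (LinearMap.snd ℝ E10 ℝ)
      (fun k => (EuclideanSpace.proj k : E10 →L[ℝ] ℝ).toLinearMap ∘ₗ LinearMap.fst ℝ E10 ℝ) i)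
    (gamma i)

theorem gammaVec_apply (x : E10) (t : ℝ) :
    gammaVec (x, t) = ∑ i : Fin 11, (Fin.snoc (α := fun _ => ℝ) x.ofLp t i : ℝ) • gamma i := by
  rw [gammaVec, LinearMap.sum_apply]
  refine Finset.sum_congr rfl fun i _ => ?_
  refine Fin.lastCases ?_ (fun k => ?_) i <;> simp [-Fin.reduceLast]

theorem gammaVec_sq (m : Minkowski) :
    gammaVec m * gammaVec m =
      algebraMap ℝ (Module.End ℝ (Fin 32 → ℝ)) (minkowskiForm m) := by
  obtain ⟨x, t⟩ := m
  set c : Fin 11 → ℝ := Fin.snoc (α := fun _ => ℝ) x.ofLp t with hc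
  have hA : gammaVec (x, t) * gammaVec (x, t) =
      ∑ i, ∑ j, (c i * c j) • (gamma i * gamma j) := by
    rw [gammaVec_apply, Finset.sum_mul_sum]
    simp only [← hc, smul_mul_smul_comm]
  have hB : gammaVec (x, t) * gammaVec (x, t) =
      ∑ i, ∑ j, (c i * c j) • (gamma j * gamma i) := by
    rw [hA, Finset.sum_comm]
    exact Finset.sum_congr rfl fun i _ => Finset.sum_congr rfl fun j _ => by
      rw [mul_comm (c j)]
  have hQ : minkowskiForm (x, t) = ∑ i, c i * c i * gammaEta i := by
    rw [Fin.sum_univ_castSucc, minkowskiForm_apply, EuclideanSpace.norm_sq_eq]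
    have : ∀ k : Fin 10, gammaEta k.castSucc = 1 := by decide
    have h10 : gammaEta (Fin.last 10) = -1 := by decide
    simp [-Fin.reduceLast, hc, this, h10, sq, sub_eq_add_neg]
  have h2 : (2 : ℝ) • (gammaVec (x, t) * gammaVec (x, t)) =
      (2 : ℝ) • algebraMap ℝ (Module.End ℝ (Fin 32 → ℝ)) (minkowskiForm (x, t)) := by
    rw [two_smul]
    nth_rewrite 1 [hA]
    rw [hB]
    simp only [← Finset.sum_add_distrib, ← smul_add, gamma_anti, smul_smul, ← Finset.sum_smul]
    rw [Algebra.algebraMap_eq_smul_one, smul_smul, hQ, Finset.mul_sum]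
    congr 1
    refine Finset.sum_congr rfl fun i _ => ?_
    simp
    ring
  exact smul_right_injective _ (two_ne_zero (α := ℝ)) h2

/-- There is a real 32-component spinor module of `Cℓ(10,1)`. -/
theorem exists_spinorModule : Nonempty (Cl →ₐ[ℝ] Module.End ℝ (Fin 32 → ℝ)) :=
  ⟨CliffordAlgebra.lift minkowskiForm ⟨gammaVec, gammaVec_sq⟩⟩

end M5Brane

end

/-! Write `J k` for the Clifford product of the `k`-th pair of frame vectors, so `J k ^ 2 = -1`, and
`A` for the action of `e₀ ∧ ξ`. Each rotated vector factors as `e (0, k)` times the rotor `cos θ k +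
sin θ k J k`, and the rotors can be moved to the right. So `e₀ ∧ R(θ) ξ` acts as `A * U`, with `U`
the product of the rotors (`rho_e0WedgeCl_rotatedPlane`).

The five operators `A` and `J 0 * J k`, `k ≠ 0`, are commuting involutions. Each of them is reversed
by an invertible operator that commutes with the other four, so all 32 sign patterns occur; since
`dim S = 32`, each joint eigenspace is a line (`exists_joint_eigenbasis`). On such a line every `J
k` equals `± J 0`, so `U` is a single rotor, whose angle is a signed sum of the `θ k`. As `A`
anticommutes with `J 0`, the solutions are spanned by the basis vectors with `A = 1` and angle zero
(`eqLocus_inf_eqLocus_eq_span`).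

Counting these vectors gives the dimension. The sign vectors concerned have first sign `1`; a global
sign change, harmless for the vanishing of the sum, turns them into those with product `-1`, a set
that the Weyl group preserves. -/

open scoped BigOperators

noncomputable section

namespace M5Brane

/-! ### Words in generators that commute up to sign. -/

section SignCommutation

variable {R : Type*} [Ring R]

/-- Two ring elements commute up to the sign `ε`. -/
def SignCommute (ε : ℤˣ) (x y : R) : Prop := x * y = (ε : ℤ) • (y * x)

theorem SignCommute.one_right (x : R) : SignCommute 1 x 1 := by
  simp [SignCommute]

theorem SignCommute.one_left (x : R) : SignCommute 1 1 x := by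
  simp [SignCommute]

theorem SignCommute.mul_right {ε δ : ℤˣ} {x y z : R} (hy : SignCommute ε x y)
    (hz : SignCommute δ x z) : SignCommute (ε * δ) x (y * z) := by
  unfold SignCommute at *
  rw [← mul_assoc, hy, smul_mul_assoc, mul_assoc y, hz, mul_smul_comm, smul_smul, Units.val_mul,
    ← mul_assoc]

theorem SignCommute.mul_left {ε δ : ℤˣ} {x y z : R} (hx : SignCommute ε x z)
    (hy : SignCommute δ y z) : SignCommute (ε * δ) (x * y) z := by
  unfold SignCommute at *
  rw [mul_assoc, hy, mul_smul_comm, ← mul_assoc, hx, smul_mul_assoc, smul_smul, Units.val_mul,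
    mul_comm (ε : ℤ), mul_assoc]

variable {α : Type*} (c : α → α → ℤˣ)

/-- The sign that arises when two words in generators with commutation signs `c` are swapped. -/
def swapSign (w w' : List α) : ℤˣ := (w.map fun x => (w'.map fun y => c x y).prod).prod

/-- The sign of the square of a word in generators with commutation signs `c` and squares `η`. -/
def squareSign (η : α → ℤˣ) : List α → ℤˣ
  | [] => 1
  | x :: w => swapSign c [x] w * η x * squareSign η w

variable {c} {G : α → R}

theorem signCommute_word (h : ∀ x y, SignCommute (c x y) (G x) (G y)) (w w' : List α) :
    SignCommute (swapSign c w w') (w.map G).prod (w'.map G).prod := by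
  induction w with
  | nil => simpa [swapSign] using SignCommute.one_left _
  | cons x w ih =>
    have hx : SignCommute (w'.map fun y => c x y).prod (G x) (w'.map G).prod := by
      clear ih
      induction w' with
      | nil => simpa using SignCommute.one_right _
      | cons y w' ih => simpa using (h x y).mul_right ih
    simpa [swapSign] using hx.mul_left ih

theorem word_mul_self (h : ∀ x y, SignCommute (c x y) (G x) (G y)) {η : α → ℤˣ}
    (hη : ∀ x, G x * G x = ((η x : ℤˣ) : ℤ) • (1 : R)) (w : List α) :
    (w.map G).prod * (w.map G).prod = ((squareSign c η w : ℤˣ) : ℤ) • (1 : R) := by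
  induction w with
  | nil => simp [squareSign]
  | cons x w ih =>
    have hx := signCommute_word h [x] w
    simp only [List.map_cons, List.map_nil, List.prod_cons, List.prod_nil, mul_one,
      SignCommute] at hx ⊢
    set P := (w.map G).prod
    have h1 : P * G x = ((swapSign c [x] w : ℤˣ) : ℤ) • (G x * P) := by
      rw [hx, smul_smul, ← Units.val_mul, Int.units_mul_self]
      simp
    rw [mul_assoc, ← mul_assoc P, h1, smul_mul_assoc, mul_smul_comm, mul_assoc (G x) P P, ih,
      mul_smul_comm, mul_smul_comm, mul_one, hη, smul_smul, smul_smul]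
    simp only [squareSign, Units.val_mul]
    congr 1
    ring

end SignCommutation

/-! ### Joint eigenbases of commuting involutions. -/

section JointEigenbasis

variable {ι : Type*} [Fintype ι] [DecidableEq ι] {V : Type*} [AddCommGroup V] [Module ℝ V]

/-- If the commuting involutions `T i` admit injective operators `F i` such that `F i` anticommutes
with `T i` and commutes with the others, then all joint eigenspaces are nonzero. -/
theorem exists_joint_eigenvector [Nontrivial V] {T F : ι → Module.End ℝ V}
    (hTT : ∀ i j, T i * T j = T j * T i) (hT : ∀ i, T i * T i = 1)
    (hF : ∀ i, Function.Injective (F i))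
    (hTF : ∀ i j, T i * F j = (if i = j then (-1 : ℝ) else 1) • (F j * T i)) (s : ι → ℤˣ) :
    ∃ v : V, v ≠ 0 ∧ ∀ i, T i v = ((s i : ℤ) : ℝ) • v := by
  have sq (i : ι) : ((s i : ℤ) : ℝ) * ((s i : ℤ) : ℝ) = 1 := by
    rcases Int.units_eq_one_or (s i) with h | h <;> simp [h]
  suffices H : ∀ I : Finset ι, ∃ v : V, v ≠ 0 ∧ ∀ i ∈ I, T i v = ((s i : ℤ) : ℝ) • v by
    simpa using H Finset.univ
  intro I
  induction I using Finset.induction_on with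
  | empty =>
    obtain ⟨v, hv⟩ := exists_ne (0 : V)
    exact ⟨v, hv, by simp⟩
  | insert j I hj ih =>
    obtain ⟨v, hv, hI⟩ := ih
    -- This vector is twice the projection of `v` to the wanted eigenspace of `T j`. If it vanishes,
    -- `v` has the opposite eigenvalue, which `F j` reverses without disturbing those already fixed.
    by_cases hw : v + ((s j : ℤ) : ℝ) • T j v = 0
    · have hjv : T j v = -(((s j : ℤ) : ℝ) • v) := by
        have := congrArg (fun w => ((s j : ℤ) : ℝ) • w) hw
        simp only [smul_add, smul_smul, sq, one_smul, smul_zero] at this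
        exact eq_neg_of_add_eq_zero_right this
      refine ⟨F j v, fun h => hv (hF j (by rw [h, map_zero])), fun i hi => ?_⟩
      have hij : T i (F j v) = (if i = j then (-1 : ℝ) else 1) • F j (T i v) :=
        LinearMap.congr_fun (hTF i j) v
      rw [hij]
      rcases Finset.mem_insert.1 hi with rfl | hi
      · rw [hjv]; simp
      · rw [if_neg (ne_of_mem_of_not_mem hi hj), hI i hi, map_smul, one_smul]
    · refine ⟨_, hw, fun i hi => ?_⟩
      rcases Finset.mem_insert.1 hi with rfl | hi
      · have : T i (T i v) = v := LinearMap.congr_fun (hT i) v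
        rw [map_add, map_smul, this, smul_add, smul_smul, sq, one_smul, add_comm]
      · have : T i (T j v) = T j (T i v) := LinearMap.congr_fun (hTT i j) v
        rw [map_add, map_smul, this, hI i hi, map_smul, smul_add, smul_comm]

/-- Eigenvectors for distinct sign patterns are independent, and there are as many patterns as
dimensions. -/
theorem exists_joint_eigenbasis (hV : Module.finrank ℝ V = 2 ^ Fintype.card ι)
    {T F : ι → Module.End ℝ V}
    (hTT : ∀ i j, T i * T j = T j * T i) (hT : ∀ i, T i * T i = 1)
    (hF : ∀ i, Function.Injective (F i))
    (hTF : ∀ i j, T i * F j = (if i = j then (-1 : ℝ) else 1) • (F j * T i)) :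
    ∃ b : Module.Basis (ι → ℤˣ) ℝ V, ∀ s i, T i (b s) = ((s i : ℤ) : ℝ) • b s := by
  have : Nontrivial V := Module.nontrivial_of_finrank_pos (R := ℝ) (by rw [hV]; positivity)
  choose v hv h using exists_joint_eigenvector hTT hT hF hTF
  have hind := Module.End.independent_iInf_maxGenEigenspace_of_forall_mapsTo T
    fun i j φ => Module.End.mapsTo_maxGenEigenspace_of_comm (hTT j i) φ
  have hinj : Function.Injective fun (s : ι → ℤˣ) (i : ι) => ((s i : ℤ) : ℝ) := fun s t hst => by
    funext i
    have := congrFun hst i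
    exact Units.ext (Int.cast_injective (α := ℝ) this)
  have hli : LinearIndependent ℝ v := by
    refine (hind.comp hinj).linearIndependent _ (fun s => ?_) hv
    simp only [Function.comp, Submodule.mem_iInf]
    intro i
    exact Module.End.mem_maxGenEigenspace _ _ _ |>.2 ⟨1, by simp [h]⟩
  refine ⟨basisOfLinearIndependentOfCardEqFinrank hli (by rw [hV, Fintype.card_fun]; rfl),
    fun s i => ?_⟩
  rw [coe_basisOfLinearIndependentOfCardEqFinrank]
  exact h s i

end JointEigenbasis

/-! ### Wedge products of orthogonal vectors as Clifford products. -/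

section Clifford

variable {R M : Type*} [CommRing R] [AddCommGroup M] [Module R M]

open CliffordAlgebra in
theorem contractLeft_list_prod_eq_zero (Q : QuadraticForm R M) (d : Module.Dual R M) (l : List M)
    (h : ∀ m ∈ l, d m = 0) : contractLeft d (l.map (ι Q)).prod = 0 := by
  induction l with
  | nil => simp
  | cons m l ih =>
    rw [List.map_cons, List.prod_cons, contractLeft_ι_mul, h m (by simp),
      ih fun m' hm' => h m' (by simp [hm'])]
    simp

open CliffordAlgebra in
/-- Changing the form does not affect products of vectors that are pairwise orthogonal for the
difference of the forms. -/
theorem changeForm_list_prod {Q Q' : QuadraticForm R M} {B : LinearMap.BilinForm R M}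
    (h : B.toQuadraticMap = Q' - Q) (l : List M) (hl : l.Pairwise fun m m' => B m m' = 0) :
    changeForm h (l.map (ι Q)).prod = (l.map (ι Q')).prod := by
  induction l with
  | nil => simp
  | cons m l ih =>
    rw [List.pairwise_cons] at hl
    rw [List.map_cons, List.prod_cons, changeForm_ι_mul, ih hl.2,
      contractLeft_list_prod_eq_zero _ _ _ hl.1]
    simp

-- The exterior algebra is the Clifford algebra of the zero form, and the isomorphism is the change
-- of form by the bilinear form associated with `Q`, which vanishes on orthogonal pairs.
open CliffordAlgebra in
theorem equivExterior_symm_list_prod [Invertible (2 : R)] (Q : QuadraticForm R M) (l : List M)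
    (hl : l.Pairwise fun m m' => Q.IsOrtho m m') :
    (equivExterior Q).symm (l.map (ExteriorAlgebra.ι R)).prod = (l.map (ι Q)).prod := by
  refine changeForm_list_prod (changeForm.neg_proof changeForm.associated_neg_proof) l
    (hl.imp fun {m m'} h => ?_)
  simpa using QuadraticMap.associated_isOrtho.2 h

theorem isOrtho_e0_inl (x : E10) : minkowskiForm.IsOrtho e0 (x, 0) := by
  rw [QuadraticMap.isOrtho_def]
  simp [e0, minkowskiForm_apply]
  ring

theorem isOrtho_inl {x y : E10} (h : inner ℝ x y = 0) :
    minkowskiForm.IsOrtho (x, 0) (y, 0) := by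
  rw [QuadraticMap.isOrtho_def]
  simp [minkowskiForm_apply, pow_two, norm_add_sq_eq_norm_sq_add_norm_sq_real h]

/-- `e₀ ∧ v₁ ∧ ⋯ ∧ v₅` is the Clifford product of `e₀, v₁, …, v₅` for orthogonal `vᵢ`. -/
theorem e0WedgeCl_ιMulti {n : ℕ} (v : Fin n → E10)
    (hv : Pairwise fun i j => inner ℝ (v i) (v j) = 0) :
    e0WedgeCl (ExteriorAlgebra.ιMulti ℝ n v) =
      CliffordAlgebra.ι minkowskiForm e0 *
        (List.ofFn fun i => CliffordAlgebra.ι minkowskiForm (v i, 0)).prod := by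
  let : Invertible (2 : ℝ) := invertibleOfNonzero two_ne_zero
  have h := equivExterior_symm_list_prod minkowskiForm
    (e0 :: List.ofFn fun i => ((v i, 0) : Minkowski)) (by
      rw [List.pairwise_cons]
      refine ⟨fun m hm => ?_, List.pairwise_ofFn.2 fun i j hij => isOrtho_inl (hv hij.ne)⟩
      obtain ⟨i, rfl⟩ := List.mem_ofFn.1 hm
      exact isOrtho_e0_inl _)
  rw [e0WedgeCl, ExteriorAlgebra.map_apply_ιMulti, ExteriorAlgebra.ιMulti_apply]
  simpa [List.map_ofFn, Function.comp_def] using h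

end Clifford

/-! ### Products of rotors and their common fixed vectors. -/

section Rotors

theorem list_prod_ofFn_mul {R : Type*} [Monoid R] {n : ℕ} (a u : Fin n → R)
    (h : ∀ i j, i ≠ j → Commute (u i) (a j)) :
    (List.ofFn fun i => a i * u i).prod = (List.ofFn a).prod * (List.ofFn u).prod := by
  induction n with
  | zero => simp
  | succ n ih =>
    have h0 : Commute (u 0) (List.ofFn fun i : Fin n => a i.succ).prod := by
      refine Commute.list_prod_right _ _ fun y hy => ?_
      obtain ⟨i, rfl⟩ := List.mem_ofFn.1 hy
      exact h _ _ (Fin.succ_ne_zero i).symm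
    simp only [List.ofFn_succ, List.prod_cons]
    rw [ih _ _ fun i j hij => h _ _ ((Fin.succ_injective n).ne hij), mul_assoc, mul_assoc,
      ← mul_assoc (u 0), h0.eq, mul_assoc]

variable {V : Type*} [AddCommGroup V] [Module ℝ V]

/-- A product of rotors `cos θ k + sin θ k J k` acts on a vector on which all `J k` agree, up to
signs, with a complex structure `K`, as a single rotor. -/
theorem prod_rotor_apply {n : ℕ} (J : Fin n → Module.End ℝ V) (K : Module.End ℝ V) (v : V)
    (σ : Fin n → ℤˣ) (θ : Fin n → Real.Angle) (h : ∀ k, J k v = ((σ k : ℤ) : ℝ) • K v)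
    (hK : ∀ k, J k (K v) = -(((σ k : ℤ) : ℝ) • v)) :
    (List.ofFn fun k => (θ k).cos • (1 : Module.End ℝ V) + (θ k).sin • J k).prod v =
      (∑ k, ((σ k : ℤˣ) : ℤ) • θ k).cos • v + (∑ k, ((σ k : ℤˣ) : ℤ) • θ k).sin • K v := by
  induction n with
  | zero => simp
  | succ n ih =>
    rw [List.ofFn_succ, List.prod_cons, Module.End.mul_apply,
      ih _ _ _ (fun k => h k.succ) fun k => hK k.succ, Fin.sum_univ_succ, Real.Angle.cos_add,
      Real.Angle.sin_add]
    simp only [map_add, map_smul, LinearMap.add_apply, LinearMap.smul_apply, Module.End.one_apply,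
      h, hK]
    -- The addition formulas, with the sign `σ 0` absorbed by the parity of sine and cosine.
    rcases Int.units_eq_one_or (σ 0) with h0 | h0 <;> simp [h0] <;> module

theorem repr_apply_of_apply_basis {ι : Type*} (b : Module.Basis ι ℝ V) {D : Module.End ℝ V}
    {d : ι → ℝ} (h : ∀ s, D (b s) = d s • b s) (x : V) (s : ι) :
    b.repr (D x) s = d s * b.repr x s := by
  have : b.coord s ∘ₗ D = d s • b.coord s := b.ext fun t => by
    by_cases hts : t = s
    · subst hts; simp [h]
    · simp [h, hts]
  exact LinearMap.congr_fun this x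

/-- `U` need not be diagonal in `b`, because `K` may move the basis vectors. Since `A` anticommutes
with `K`, the sine terms cancel in `A * U * A + U`, which is diagonal with entries `2 cos φ` and
acts as `2` on solutions. -/
theorem eqLocus_inf_eqLocus_eq_span {ι : Type*} (b : Module.Basis ι ℝ V) {A U K : Module.End ℝ V}
    {a : ι → ℤˣ} {φ : ι → Real.Angle} (hA : ∀ s, A (b s) = ((a s : ℤ) : ℝ) • b s)
    (hU : ∀ s, U (b s) = (φ s).cos • b s + (φ s).sin • K (b s)) (hAA : A * A = 1)
    (hAK : A * K = -(K * A)) :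
    LinearMap.eqLocus A LinearMap.id ⊓ LinearMap.eqLocus (A * U) LinearMap.id =
      Submodule.span ℝ (b '' {s | a s = 1 ∧ φ s = 0}) := by
  apply le_antisymm
  · rintro x ⟨h1 : A x = x, h2 : A (U x) = x⟩
    have hUx : U x = x := by
      have h3 : A (A (U x)) = U x := LinearMap.congr_fun hAA (U x)
      rw [← h3, h2, h1]
    have hD : ∀ s, (A * U * A + U) (b s) = (2 * (φ s).cos) • b s := fun s => by
      have hAKb : A (K (b s)) = -K (A (b s)) := LinearMap.congr_fun hAK (b s)
      simp only [LinearMap.add_apply, Module.End.mul_apply, hA, map_smul, hU, map_add, hAKb]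
      rcases Int.units_eq_one_or (a s) with h0 | h0 <;> simp [h0] <;> module
    rw [b.mem_span_image]
    intro s hs
    have hs : b.repr x s ≠ 0 := by simpa using hs
    have e1 := repr_apply_of_apply_basis b hA x s
    have e2 := repr_apply_of_apply_basis b hD x s
    rw [h1] at e1
    rw [LinearMap.add_apply, Module.End.mul_apply, Module.End.mul_apply, h1, hUx, h1] at e2
    simp only [map_add, Finsupp.add_apply] at e2
    refine ⟨?_, ?_⟩
    · have : ((a s : ℤ) : ℝ) = 1 := mul_right_cancel₀ hs (by rw [← e1, one_mul])
      exact Units.ext (Int.cast_injective (α := ℝ) (by simpa using this))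
    · have : (φ s).cos = 1 := mul_right_cancel₀ hs (by linarith)
      simpa using Real.Angle.cos_eq_iff_eq_or_eq_neg.1 (this.trans Real.Angle.cos_zero.symm)
  · rw [Submodule.span_le]
    rintro _ ⟨s, ⟨h1, h2⟩, rfl⟩
    have hb : A (b s) = b s := by rw [hA, h1]; simp
    exact ⟨hb, by simp [hU, h2, hb]⟩

theorem finrank_span_basis_image {ι : Type*} (b : Module.Basis ι ℝ V) (s : Set ι) [Finite s] :
    Module.finrank ℝ (Submodule.span ℝ (b '' s)) = s.ncard := by
  have := Fintype.ofFinite s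
  have h := finrank_span_eq_card (b.linearIndependent.comp _ (Subtype.val_injective (p := (· ∈ s))))
  rw [Set.range_comp, Subtype.range_coe] at h
  rw [Set.ncard_def, Set.encard, ENat.card_eq_coe_fintype_card]
  exact h

end Rotors

/-! ### The spinor module in an orthonormal frame. -/

section Frame

/-- The vectors `e₀` and `e (i, k)` of Minkowski space. -/
def frameVector (e : Frame) : Option (Fin 2 × Fin 5) → Minkowski
  | none => e0
  | some x => (e x, 0)

/-- The commutation signs of the Clifford generators of a frame. -/
def frameSign (x y : Option (Fin 2 × Fin 5)) : ℤˣ := if x = y then 1 else -1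

/-- The squares of the Clifford generators of a frame. -/
def frameEta : Option (Fin 2 × Fin 5) → ℤˣ
  | none => -1
  | some _ => 1

/-- The word `e₀ e₁ e₃ e₅ e₇ e₉`. -/
def planeWord : List (Option (Fin 2 × Fin 5)) :=
  none :: List.ofFn fun k : Fin 5 => some (0, k)

/-- The word of the generator of the rotations in the `k`-th plane. -/
def pairWord (k : Fin 5) : List (Option (Fin 2 × Fin 5)) := [some (0, k), some (1, k)]

/-- Words whose Clifford products are commuting involutions. -/
def involutionWord (k : Fin 5) : List (Option (Fin 2 × Fin 5)) :=
  if k = 0 then planeWord else pairWord 0 ++ pairWord k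

/-- Words that anticommute with the involution of the same index and commute with the others. -/
def flipWord (k : Fin 5) : List (Option (Fin 2 × Fin 5)) :=
  if k = 0 then pairWord 0 else [some (1, k)]

theorem swapSign_involutionWord (i j : Fin 5) :
    swapSign frameSign (involutionWord i) (involutionWord j) = 1 := by
  revert i j; decide

/-- A letter outside a word meets one sign per letter of the word, a letter inside one sign fewer.
So `e (1, k)` commutes with the six-letter `planeWord`, while `e (0, k)` anticommutes with it, as
does `pairWord 0`. -/
theorem swapSign_involutionWord_flipWord (i j : Fin 5) :
    swapSign frameSign (involutionWord i) (flipWord j) = if i = j then -1 else 1 := by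
  revert i j; decide

theorem squareSign_involutionWord (i : Fin 5) :
    squareSign frameSign frameEta (involutionWord i) = 1 := by
  revert i; decide

theorem swapSign_pairWord (i j : Fin 5) :
    swapSign frameSign (pairWord i) (pairWord j) = 1 := by
  revert i j; decide

theorem squareSign_pairWord (i : Fin 5) :
    squareSign frameSign frameEta (pairWord i) = -1 := by
  revert i; decide

theorem swapSign_pairWord_of_ne (i j : Fin 5) (h : i ≠ j) :
    swapSign frameSign (pairWord i) [some (0, j)] = 1 := by
  revert i j; decide

variable {S : Type*} [AddCommGroup S] [Module ℝ S] (ρ : Cl →ₐ[ℝ] Module.End ℝ S) (e : Frame)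

/-- The action on spinors of a generator of the Clifford algebra. -/
def frameGamma (x : Option (Fin 2 × Fin 5)) : Module.End ℝ S :=
  ρ (CliffordAlgebra.ι minkowskiForm (frameVector e x))

/-- The action on spinors of a word in the generators. -/
def frameWord (w : List (Option (Fin 2 × Fin 5))) : Module.End ℝ S :=
  (w.map (frameGamma ρ e)).prod

theorem frameWord_append (w w' : List (Option (Fin 2 × Fin 5))) :
    frameWord ρ e (w ++ w') = frameWord ρ e w * frameWord ρ e w' := by
  simp [frameWord]

theorem isOrtho_frameVector {x y : Option (Fin 2 × Fin 5)} (h : x ≠ y) :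
    minkowskiForm.IsOrtho (frameVector e x) (frameVector e y) := by
  match x, y with
  | none, none => exact absurd rfl h
  | none, some y => exact isOrtho_e0_inl _
  | some x, none => exact (isOrtho_e0_inl _).symm
  | some x, some y => exact isOrtho_inl (e.inner_eq_zero fun hxy => h (congrArg some hxy))

theorem signCommute_frameGamma (x y : Option (Fin 2 × Fin 5)) :
    SignCommute (frameSign x y) (frameGamma ρ e x) (frameGamma ρ e y) := by
  by_cases h : x = y
  · subst h; simp [SignCommute, frameSign]
  · rw [SignCommute, frameSign, if_neg h, frameGamma, frameGamma, ← map_mul ρ, ← map_mul ρ,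
      CliffordAlgebra.ι_mul_ι_comm_of_isOrtho (isOrtho_frameVector e h)]
    simp

theorem frameGamma_mul_self (x : Option (Fin 2 × Fin 5)) :
    frameGamma ρ e x * frameGamma ρ e x = ((frameEta x : ℤˣ) : ℤ) • (1 : Module.End ℝ S) := by
  rw [frameGamma, ← map_mul, CliffordAlgebra.ι_sq_scalar, AlgHom.commutes]
  cases x <;> simp [frameVector, e0, frameEta, minkowskiForm_apply]

theorem frameWord_mul_frameWord (w w' : List (Option (Fin 2 × Fin 5))) :
    frameWord ρ e w * frameWord ρ e w' =
      ((swapSign frameSign w w' : ℤˣ) : ℤ) • (frameWord ρ e w' * frameWord ρ e w) :=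
  signCommute_word (signCommute_frameGamma ρ e) w w'

theorem frameWord_mul_self (w : List (Option (Fin 2 × Fin 5))) :
    frameWord ρ e w * frameWord ρ e w =
      ((squareSign frameSign frameEta w : ℤˣ) : ℤ) • (1 : Module.End ℝ S) :=
  word_mul_self (signCommute_frameGamma ρ e) (frameGamma_mul_self ρ e) w

theorem frameWord_injective (w : List (Option (Fin 2 × Fin 5))) :
    Function.Injective (frameWord ρ e w) := by
  refine (injective_iff_map_eq_zero _).2 fun v hv => ?_
  have h := LinearMap.congr_fun (frameWord_mul_self ρ e w) v
  rw [Module.End.mul_apply, hv, map_zero] at h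
  rcases Int.units_eq_one_or (squareSign frameSign frameEta w) with h0 | h0 <;>
    simpa [h0, eq_comm] using h

theorem exists_frame_eigenbasis (hS : Module.finrank ℝ S = 32) :
    ∃ b : Module.Basis (Fin 5 → ℤˣ) ℝ S,
      ∀ s i, frameWord ρ e (involutionWord i) (b s) = ((s i : ℤ) : ℝ) • b s := by
  refine exists_joint_eigenbasis (F := fun i => frameWord ρ e (flipWord i)) (by simpa using hS)
    (fun i j => ?_) (fun i => ?_) (fun i => frameWord_injective ρ e _) fun i j => ?_
  · rw [frameWord_mul_frameWord, swapSign_involutionWord]; simp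
  · rw [frameWord_mul_self, squareSign_involutionWord]; simp
  · rw [frameWord_mul_frameWord, swapSign_involutionWord_flipWord]
    split_ifs <;> simp

/-- The product of the rotors by the angles `θ k` in the planes `(e (0, k), e (1, k))`. -/
def rotor (θ : Torus) : Module.End ℝ S :=
  (List.ofFn fun k => (θ k).cos • (1 : Module.End ℝ S) +
    (θ k).sin • frameWord ρ e (pairWord k)).prod

/-- The rotor of one plane commutes with the first frame vectors of the other planes, so all rotors
can be collected on the right. -/
theorem rho_e0WedgeCl_rotatedPlane (θ : Torus) :
    ρ (e0WedgeCl (rotatedPlane e θ)) = frameWord ρ e planeWord * rotor ρ e θ := by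
  have hv : Pairwise fun i j : Fin 5 =>
      inner ℝ ((θ i).cos • e (0, i) + (θ i).sin • e (1, i))
        ((θ j).cos • e (0, j) + (θ j).sin • e (1, j)) = 0 := fun i j hij => by
    simp [inner_add_left, inner_add_right, inner_smul_left, inner_smul_right,
      orthonormal_iff_ite.1 e.orthonormal, hij]
  have hfac (k : Fin 5) :
      ρ (CliffordAlgebra.ι minkowskiForm ((θ k).cos • e (0, k) + (θ k).sin • e (1, k), 0)) =
        frameGamma ρ e (some (0, k)) * ((θ k).cos • (1 : Module.End ℝ S) +
          (θ k).sin • frameWord ρ e (pairWord k)) := by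
    have h1 : (((θ k).cos • e (0, k) + (θ k).sin • e (1, k), 0) : Minkowski) =
        (θ k).cos • frameVector e (some (0, k)) + (θ k).sin • frameVector e (some (1, k)) := by
      simp [frameVector]
    -- As `e (0, k)` squares to one, `e (1, k)` equals `e (0, k)` times the product of the pair.
    have h2 := frameGamma_mul_self ρ e (some (0, k))
    simp only [frameEta, Units.val_one, one_smul] at h2
    rw [h1, map_add, map_add, map_smul, map_smul, map_smul, map_smul, mul_add, mul_smul_comm,
      mul_smul_comm, mul_one]
    simp only [frameWord, pairWord, List.map_cons, List.map_nil, List.prod_cons, List.prod_nil,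
      mul_one, ← mul_assoc, h2, one_mul]
    rfl
  have hcomm (i j : Fin 5) (hij : i ≠ j) :
      Commute ((θ i).cos • (1 : Module.End ℝ S) + (θ i).sin • frameWord ρ e (pairWord i))
        (frameGamma ρ e (some (0, j))) := by
    have h := frameWord_mul_frameWord ρ e (pairWord i) [some (0, j)]
    rw [swapSign_pairWord_of_ne i j hij] at h
    have h' : Commute (frameWord ρ e (pairWord i)) (frameGamma ρ e (some (0, j))) := by
      simpa [frameWord, Commute, SemiconjBy] using h
    exact ((Commute.one_left _).smul_left _).add_left (h'.smul_left _)
  rw [rotatedPlane_eq, e0WedgeCl_ιMulti _ hv, map_mul, map_list_prod, List.map_ofFn]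
  have h := list_prod_ofFn_mul _ _ hcomm
  simp only [Function.comp_def, hfac]
  rw [h, rotor, ← mul_assoc]
  congr 1

theorem rho_e0WedgeCl_plane :
    ρ (e0WedgeCl (plane e)) = frameWord ρ e planeWord := by
  have h : plane e = rotatedPlane e 0 := by
    rw [rotatedPlane_eq, plane]; simp
  rw [h, rho_e0WedgeCl_rotatedPlane, rotor]
  simp

/-- The relative signs of the complex structures `frameWord (pairWord k)` on the joint eigenspace
labelled by `s`. -/
def pairSign (s : Fin 5 → ℤˣ) (k : Fin 5) : ℤˣ := if k = 0 then 1 else -s k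

theorem finrank_solutionSpace_eq_ncard (hS : Module.finrank ℝ S = 32) (θ : Torus) :
    Module.finrank ℝ (solutionSpace ρ e θ) =
      {s : Fin 5 → ℤˣ | s 0 = 1 ∧ signedSum (pairSign s) θ = 0}.ncard := by
  obtain ⟨b, hb⟩ := exists_frame_eigenbasis ρ e hS
  have hKK (v : S) : frameWord ρ e (pairWord 0) (frameWord ρ e (pairWord 0) v) = -v := by
    have := LinearMap.congr_fun (frameWord_mul_self ρ e (pairWord 0)) v
    rw [squareSign_pairWord] at this
    simpa using this
  have hJ (s : Fin 5 → ℤˣ) (k : Fin 5) : frameWord ρ e (pairWord k) (b s) =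
      ((pairSign s k : ℤ) : ℝ) • frameWord ρ e (pairWord 0) (b s) := by
    by_cases hk : k = 0
    · subst hk; simp [pairSign]
    · have h := hb s k
      rw [involutionWord, if_neg hk, frameWord_append, Module.End.mul_apply] at h
      -- With `J k` the action of `pairWord k`, applying `J 0` to `J 0 (J k (b s)) = s k • b s`
      -- gives `J k (b s) = -s k • J 0 (b s)`, the source of the minus sign in `pairSign`.
      have h' := congrArg (frameWord ρ e (pairWord 0)) h
      rw [hKK, map_smul, neg_eq_iff_eq_neg] at h'
      simp [h', pairSign, hk]
  rw [solutionSpace, rho_e0WedgeCl_rotatedPlane, rho_e0WedgeCl_plane,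
    eqLocus_inf_eqLocus_eq_span b (A := frameWord ρ e planeWord) (a := fun s => s 0)
      (K := frameWord ρ e (pairWord 0)) (φ := fun s => signedSum (pairSign s) θ)
      (fun s => hb s 0) ?_ ?_ ?_, finrank_span_basis_image]
  · intro s
    refine prod_rotor_apply _ _ _ _ _ (hJ s) fun k => ?_
    have h := LinearMap.congr_fun (frameWord_mul_frameWord ρ e (pairWord k) (pairWord 0)) (b s)
    rw [swapSign_pairWord] at h
    simp only [Module.End.mul_apply, Units.val_one, one_smul] at h
    rw [h, hJ, map_smul, hKK, smul_neg]
  · have := frameWord_mul_self ρ e (involutionWord 0)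
    rw [squareSign_involutionWord] at this
    simpa [involutionWord] using this
  · have := frameWord_mul_frameWord ρ e (involutionWord 0) (flipWord 0)
    rw [swapSign_involutionWord_flipWord] at this
    simpa [involutionWord, flipWord] using this

end Frame

/-! ### Sign vectors and the Weyl group. -/

section Signs

theorem signedSum_neg (σ : Fin 5 → ℤˣ) (θ : Torus) : signedSum (-σ) θ = -signedSum σ θ := by
  simp [signedSum]

theorem signedSum_smul_eq_zero_iff (u : ℤˣ) (σ : Fin 5 → ℤˣ) (θ : Torus) :
    signedSum (fun k => u * σ k) θ = 0 ↔ signedSum σ θ = 0 := by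
  rcases Int.units_eq_one_or u with rfl | rfl
  · simp
  · have : (fun k => -1 * σ k) = -σ := by funext k; simp
    rw [this, signedSum_neg, neg_eq_zero]

/-- Of the pair `σ`, `-σ`, exactly one has product `-1`, because five is odd, and exactly one has
first sign `1`. Both sides count such pairs with vanishing signed sum. -/
theorem ncard_pairSign_eq (θ : Torus) :
    {s : Fin 5 → ℤˣ | s 0 = 1 ∧ signedSum (pairSign s) θ = 0}.ncard =
      {σ : Fin 5 → ℤˣ | ∏ i, σ i = -1 ∧ signedSum σ θ = 0}.ncard := by
  refine Set.ncard_congr (fun s _ k => (-∏ i, pairSign s i) * pairSign s k) ?_ ?_ ?_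
  · rintro s ⟨-, h2⟩
    refine ⟨?_, (signedSum_smul_eq_zero_iff _ _ _).2 h2⟩
    generalize pairSign s = t
    revert t; decide +kernel
  · rintro s t ⟨hs, -⟩ ⟨ht, -⟩ hst
    have h0 : ∏ i, pairSign s i = ∏ i, pairSign t i := by
      simpa [pairSign] using congrFun hst 0
    funext k
    have hk := congrFun hst k
    rw [h0, mul_right_inj] at hk
    by_cases h : k = 0
    · rw [h, hs, ht]
    · simpa [pairSign, h] using hk
  · rintro σ ⟨h1, h2⟩
    -- For this preimage, `pairSign` is `σ 0 * σ k` for all `k`; its product is `-σ 0`, so the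
    -- normalizing factor is `σ 0` and restores `σ`.
    have key : (fun k => (-∏ i, pairSign (fun k => if k = 0 then 1 else -(σ 0 * σ k)) i) *
        pairSign (fun k => if k = 0 then 1 else -(σ 0 * σ k)) k) = σ := by
      clear h2; revert σ; decide +kernel
    have h := h2
    rw [← key, signedSum_smul_eq_zero_iff] at h
    exact ⟨_, ⟨by simp, h⟩, key⟩

/-- The Weyl action on the angles is transposed to the sign vectors; the product is kept because the
number of sign changes is even. -/
theorem exists_sign_of_weylRel {θ θ' : Torus} (h : weylRel θ θ') :
    ∃ f : (Fin 5 → ℤˣ) → (Fin 5 → ℤˣ), Function.Injective f ∧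
      ∀ σ, ∏ i, f σ i = ∏ i, σ i ∧ signedSum (f σ) θ = signedSum σ θ' := by
  obtain ⟨p, s, hs, h⟩ := h
  refine ⟨fun σ k => σ (p⁻¹ k) * s (p⁻¹ k), fun σ τ hst => ?_, fun σ => ⟨?_, ?_⟩⟩
  · funext k
    simpa using congrFun hst (p k)
  · rw [Equiv.prod_comp p⁻¹ fun k => σ k * s k, Finset.prod_mul_distrib, hs, mul_one]
  · rw [signedSum, signedSum, ← Equiv.sum_comp p]
    refine Finset.sum_congr rfl fun k _ => ?_
    simp [h, smul_smul]

theorem ncard_le_of_weylRel {θ θ' : Torus} (h : weylRel θ θ') :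
    {σ : Fin 5 → ℤˣ | ∏ i, σ i = -1 ∧ signedSum σ θ' = 0}.ncard ≤
      {σ : Fin 5 → ℤˣ | ∏ i, σ i = -1 ∧ signedSum σ θ = 0}.ncard := by
  obtain ⟨f, hf, hfσ⟩ := exists_sign_of_weylRel h
  refine Set.ncard_le_ncard_of_injOn f (fun σ hσ => ?_) hf.injOn
  exact ⟨(hfσ σ).1.trans hσ.1, (hfσ σ).2.trans hσ.2⟩

theorem exists_sign_iff_exists_angleClass (θ : Torus) :
    (∃ σ : Fin 5 → ℤˣ, ∏ i, σ i = -1 ∧ signedSum σ θ = 0) ↔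
      ∃ θ' : Torus, angleClass θ' = angleClass θ ∧ θ' 0 + θ' 1 + θ' 2 + θ' 3 = θ' 4 := by
  constructor
  · rintro ⟨σ, h1, h2⟩
    -- The multipliers differ from `σ` in one place, so their product is `1` and they form a Weyl
    -- element; it carries `σ` to the pattern `(1, 1, 1, 1, -1)`.
    refine ⟨fun i => ((if i = 4 then -σ i else σ i : ℤˣ) : ℤ) • θ i, ?_, ?_⟩
    · refine Quotient.sound (weylRel_equivalence.symm ⟨1, fun i => if i = 4 then -σ i else σ i,
        ?_, fun i => rfl⟩)
      rw [Fin.prod_univ_five] at h1 ⊢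
      simp [h1]
    · rw [signedSum, Fin.sum_univ_five] at h2
      simpa using eq_neg_of_add_eq_zero_left h2
  · rintro ⟨θ', h, h'⟩
    have hrel : weylRel θ θ' := weylRel_equivalence.symm (Quotient.exact h)
    obtain ⟨f, -, hf⟩ := exists_sign_of_weylRel hrel
    refine ⟨f (fun i => if i = 4 then -1 else 1), (hf _).1.trans (by decide), (hf _).2.trans ?_⟩
    rw [signedSum, Fin.sum_univ_five]
    simp only [Fin.isValue, Fin.reduceEq, if_false, if_true, Units.val_one, Units.val_neg,
      one_smul, neg_smul, h', add_neg_cancel]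

end Signs

/-! ### Dimension and existence of solutions. -/

section Main

variable {S : Type*} [AddCommGroup S] [Module ℝ S]

theorem finrank_solutionSpace (hS : Module.finrank ℝ S = 32) (ρ : Cl →ₐ[ℝ] Module.End ℝ S)
    (e : Frame) (θ : Torus) :
    Module.finrank ℝ (solutionSpace ρ e θ) =
      {σ : Fin 5 → ℤˣ | ∏ i, σ i = -1 ∧ signedSum σ θ = 0}.ncard :=
  (finrank_solutionSpace_eq_ncard ρ e hS θ).trans (ncard_pairSign_eq θ)

theorem exists_solution_iff (hS : Module.finrank ℝ S = 32) (ρ : Cl →ₐ[ℝ] Module.End ℝ S)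
    (e : Frame) (θ : Torus) :
    (∃ ε : S, ε ≠ 0 ∧ ρ (e0WedgeCl (plane e)) ε = ε ∧
        ρ (e0WedgeCl (rotatedPlane e θ)) ε = ε) ↔
      ∃ θ' : Torus, angleClass θ' = angleClass θ ∧ θ' 0 + θ' 1 + θ' 2 + θ' 3 = θ' 4 := by
  have : FiniteDimensional ℝ S := Module.finite_of_finrank_pos (by rw [hS]; norm_num)
  rw [← exists_sign_iff_exists_angleClass]
  have h1 : (∃ ε : S, ε ≠ 0 ∧ ρ (e0WedgeCl (plane e)) ε = ε ∧
      ρ (e0WedgeCl (rotatedPlane e θ)) ε = ε) ↔ solutionSpace ρ e θ ≠ ⊥ := by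
    rw [Submodule.ne_bot_iff]
    exact exists_congr fun ε => and_comm
  rw [h1, ← Submodule.one_le_finrank_iff, finrank_solutionSpace hS, Nat.one_le_iff_ne_zero,
    ← Nat.pos_iff_ne_zero, Set.ncard_pos]
  rfl

end Main

end M5Brane

end

theorem mainTheorem1 {S : Type*} [AddCommGroup S] [Module ℝ S]
    (hS : Module.finrank ℝ S = 32)
    (ρ : M5Brane.Cl →ₐ[ℝ] Module.End ℝ S) (e : M5Brane.Frame) :
    M5Brane.susyAngles ρ e =
        {m | ∃ θ : M5Brane.Torus, M5Brane.angleClass θ = m ∧ θ 0 + θ 1 + θ 2 + θ 3 = θ 4} ∧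
      (∀ θ : M5Brane.Torus,
        (∃ ε : S, ε ≠ 0 ∧ ρ (M5Brane.e0WedgeCl (M5Brane.plane e)) ε = ε ∧
            ρ (M5Brane.e0WedgeCl (M5Brane.rotatedPlane e θ)) ε = ε) ↔
          ∃ θ' : M5Brane.Torus, M5Brane.angleClass θ' = M5Brane.angleClass θ ∧
            θ' 0 + θ' 1 + θ' 2 + θ' 3 = θ' 4) ∧
      (∀ θ : M5Brane.Torus,
        Module.finrank ℝ (M5Brane.solutionSpace ρ e θ) =
          {σ : Fin 5 → ℤˣ | ∏ i, σ i = -1 ∧ M5Brane.signedSum σ θ = 0}.ncard) ∧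
      (∀ θ θ' : M5Brane.Torus, M5Brane.angleClass θ = M5Brane.angleClass θ' →
        Module.finrank ℝ (M5Brane.solutionSpace ρ e θ) =
          Module.finrank ℝ (M5Brane.solutionSpace ρ e θ')) := by
  refine ⟨?_, M5Brane.exists_solution_iff hS ρ e, M5Brane.finrank_solutionSpace hS ρ e,
    fun θ θ' h => ?_⟩
  · ext m
    constructor
    · rintro ⟨θ, rfl, hθ⟩
      exact (M5Brane.exists_solution_iff hS ρ e θ).1 hθ
    · rintro ⟨θ, rfl, hθ⟩
      exact ⟨θ, rfl, (M5Brane.exists_solution_iff hS ρ e θ).2 ⟨θ, rfl, hθ⟩⟩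
  · have hrel : M5Brane.weylRel θ θ' := Quotient.exact h
    rw [M5Brane.finrank_solutionSpace hS, M5Brane.finrank_solutionSpace hS]
    exact le_antisymm (M5Brane.ncard_le_of_weylRel (M5Brane.weylRel_equivalence.symm hrel))
      (M5Brane.ncard_le_of_weylRel hrel)
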